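/- Let $d\ge 1$ and let $T_d\subset\mathbb{R}^d$ be a non-degenerate $d$-simplex, i.e. the convex hull of a set $V$ of $d+1$ affinely independent points. For a convex body $K$ of dimension $m$ in a Euclidean space and integers $n,k\ge 0$ put $$v_n^{(k)}(K)=\frac{\mathbb{E}\big[\operatorname{vol}_m(\operatorname{conv}(X_0,\dots,X_n))^k\big]}{(\operatorname{vol}_m K)^k},$$ where $X_0,\dots,X_n$ are independent and uniformly distributed in $K$ (for $m=0$, $\operatorname{vol}_0$ is the counting measure). For $\eta\in\mathbb{R}^d\setminus\{0\}$ let $\sigma=\sigma_\eta=\{x\in\mathbb{R}^d:\eta^\top x=1\}$ and $$\zeta_d(\sigma)=\frac{\operatorname{vol}_{d-1}(\sigma\cap T_d)}{\|\eta\|\operatorname{vol}_d T_d},\qquad \iota_d^{(k)}(\sigma)=\int_{T_d}|\eta^\top x-1|^k\,dx.$$ Fix a vertex $v\in V$, and let $D_{\mathrm{I}}$ be the set of all $\eta\in\mathbb{R}^d$ for which $\sigma_\eta$ strictly separates $v$ from the remaining $d$ vertices, that is, either $\eta^\top v<1$ and $\eta^\top w>1$ for all $w\in V\setminus\{v\}$,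 or the same with both inequalities reversed. Define the section integral of this configuration by $$v_d^{(k)}(T_d)_{\mathrm{I}}=\frac{(d-1)!}{d^k}\int_{D_{\mathrm{I}}}v_{d-1}^{(k+1)}(\sigma\cap T_d)\,\zeta_d(\sigma)^{d+k+1}\,\iota_d^{(k)}(\sigma)\,d\eta .$$ Then $$v_d^{(1)}(T_d)_{\mathrm{I}}=2\,v_d^{(2)}(T_d)=\frac{2\,d!}{(d+1)^d(d+2)^d}.$$ -/

import Mathlib

open MeasureTheory
open scoped RealInnerProductSpace

noncomputable section

namespace SimplexSection

/-- The metric moment `v_n^{(k)}(K)` of an `m`-dimensional set `K` in a Euclidean space: the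
expectation of the `k`-th power of the `m`-volume of the convex hull of `n + 1` independent points
drawn uniformly from `K`, divided by the `k`-th power of the `m`-volume of `K`.
The `m`-volume is the `m`-dimensional Hausdorff measure `μHE[m]`, normalised so that it is
Lebesgue measure on `m`-dimensional affine subspaces. -/
def metricMoment {d : ℕ} (m n k : ℕ) (K : Set (EuclideanSpace ℝ (Fin d))) : ℝ :=
  (∫ x : Fin (n + 1) → EuclideanSpace ℝ (Fin d),
      (μHE[m].real (convexHull ℝ (Set.range x))) ^ k
        ∂(Measure.pi fun _ : Fin (n + 1) => ProbabilityTheory.cond μHE[m] K))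
    / (μHE[m].real K) ^ k

variable {d : ℕ}

/-- The hyperplane `{x | ηᵀ x = 1}`. -/
def hyperplane (η : EuclideanSpace ℝ (Fin d)) : Set (EuclideanSpace ℝ (Fin d)) :=
  {x | ⟪η, x⟫ = 1}

/-- `ζ_d(σ) = vol_{d-1}(σ ∩ K) / (‖η‖ vol_d K)`. -/
def zeta (K : Set (EuclideanSpace ℝ (Fin d))) (η : EuclideanSpace ℝ (Fin d)) : ℝ :=
  μHE[d - 1].real (hyperplane η ∩ K) / (‖η‖ * volume.real K)

/-- `ι_d^{(k)}(σ) = ∫_K |ηᵀ x - 1|^k dx`. -/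
def iota (k : ℕ) (K : Set (EuclideanSpace ℝ (Fin d))) (η : EuclideanSpace ℝ (Fin d)) : ℝ :=
  ∫ x in K, |⟪η, x⟫ - 1| ^ k

/-- The set of all `η` for which the hyperplane `{x | ηᵀ x = 1}` strictly separates the points of
`S` from the other points of `V`. -/
def separatingSet (V S : Set (EuclideanSpace ℝ (Fin d))) : Set (EuclideanSpace ℝ (Fin d)) :=
  {η | (∀ v ∈ S, ⟪η, v⟫ < 1) ∧ ∀ v ∈ V \ S, 1 < ⟪η, v⟫} ∪
    {η | (∀ v ∈ S, 1 < ⟪η, v⟫) ∧ ∀ v ∈ V \ S, ⟪η, v⟫ < 1}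

/-- The section integral `v_d^{(k)}(P)_C` of the polytope `P` with vertex set `V` in the
configuration `C` in which the cutting hyperplane separates `S` from the other vertices. -/
def sectionIntegral (k : ℕ) (V S : Set (EuclideanSpace ℝ (Fin d))) : ℝ :=
  ((d - 1).factorial : ℝ) / (d : ℝ) ^ k *
    ∫ η in separatingSet V S,
      metricMoment (d - 1) (d - 1) (k + 1) (hyperplane η ∩ convexHull ℝ V)
        * zeta (convexHull ℝ V) η ^ (d + k + 1) * iota k (convexHull ℝ V) η

end SimplexSection

end

namespace SimplexSection

/-! Both sides are evaluated in closed form and compared; write `d = m + 1`, let `v` be the chosen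
vertex and `e_j` the edges leaving it.

A simplex is the affine image of the corner simplex, so normalised volumes of random simplices do
not depend on its shape: they equal `|det|` of the matrix of barycentric coordinates of the random
points. The expected squared determinant is a factorial times the determinant of the matrix of
second moments, which is a multiple of `1 + J` with `J` the all-ones matrix. This gives
`metricMoment_simplex`.

For the section integral, substitute `η = s • ξ` with `s = (1 + ⟪v, ξ⟫)⁻¹`, and put `u_j = ⟪e_j,
ξ⟫`. Up to a null set the separating hyperplanes become the orthant `u_j > 1`. The section is the
simplex with vertices `v + e_j / u_j`, so its moment is the constant just found; `zeta` is `d / (|s|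
∏ u_j)`, and `iota` is `|s|` times an explicit function of `u`. The Jacobian `|s| ^ (d + 1)` makes
all powers of `s` cancel (`section_integrand`). Passing from `ξ` to `u` leaves an integral over `(1,
∞)^d` that splits into products of one-dimensional power integrals (`setIntegral_orthant`). -/

/-! ### Simplices as affine images of the corner simplex -/

/-- The linear map sending the standard basis of `ℝᵐ` to the family `u`. -/
noncomputable def linComb {m d : ℕ} (u : Fin m → EuclideanSpace ℝ (Fin d)) :
    EuclideanSpace ℝ (Fin m) →ₗ[ℝ] EuclideanSpace ℝ (Fin d) :=
  (Fintype.linearCombination ℝ u) ∘ₗ (WithLp.linearEquiv 2 ℝ (Fin m → ℝ)).toLinearMap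

theorem linComb_apply {m d : ℕ} (u : Fin m → EuclideanSpace ℝ (Fin d))
    (x : EuclideanSpace ℝ (Fin m)) : linComb u x = ∑ i, x i • u i := by
  simp [linComb, Fintype.linearCombination_apply]

/-- The edge vectors of the simplex with vertices `p` that start at `p 0`. -/
def edge {m d : ℕ} (p : Fin (m + 1) → EuclideanSpace ℝ (Fin d)) (i : Fin m) :
    EuclideanSpace ℝ (Fin d) := p i.succ - p 0

/-- The affine map sending the vertices of the corner simplex to the points `p`. -/
noncomputable def simplexMap {m d : ℕ} (p : Fin (m + 1) → EuclideanSpace ℝ (Fin d))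
    (x : EuclideanSpace ℝ (Fin m)) : EuclideanSpace ℝ (Fin d) := p 0 + linComb (edge p) x

/-- The corner simplex `{x | 0 ≤ x, ∑ xᵢ ≤ 1}`. -/
def corner (m : ℕ) : Set (EuclideanSpace ℝ (Fin m)) := {x | (∀ i, 0 ≤ x i) ∧ ∑ i, x i ≤ 1}

/-- Barycentric coordinates with respect to the vertices of the corner simplex. -/
def bary {m : ℕ} (x : EuclideanSpace ℝ (Fin m)) : Fin (m + 1) → ℝ := Fin.cons (1 - ∑ i, x i) x

theorem simplexMap_eq_sum_bary {m d : ℕ} (p : Fin (m + 1) → EuclideanSpace ℝ (Fin d))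
    (x : EuclideanSpace ℝ (Fin m)) : simplexMap p x = ∑ i, bary x i • p i := by
  simp [simplexMap, linComb_apply, Fin.sum_univ_succ, bary, edge, smul_sub, sub_smul,
    Finset.sum_smul]
  abel

theorem sum_bary {m : ℕ} (x : EuclideanSpace ℝ (Fin m)) : ∑ i, bary x i = 1 := by
  simp [Fin.sum_univ_succ, bary]

theorem bary_nonneg {m : ℕ} {x : EuclideanSpace ℝ (Fin m)} (hx : x ∈ corner m)
    (i : Fin (m + 1)) : 0 ≤ bary x i := by
  refine Fin.cases ?_ (fun j => ?_) i
  · simpa [bary] using hx.2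
  · simpa [bary] using hx.1 j

theorem mem_convexHull_range_iff {m d : ℕ} {p : Fin m → EuclideanSpace ℝ (Fin d)}
    {y : EuclideanSpace ℝ (Fin d)} : y ∈ convexHull ℝ (Set.range p) ↔
      ∃ w : Fin m → ℝ, ((∀ i, 0 ≤ w i) ∧ ∑ i, w i = 1) ∧ ∑ i, w i • p i = y := by
  have h : Set.range p = (Fintype.linearCombination ℝ p) ''
      (Set.range fun i : Fin m => (Pi.single i 1 : Fin m → ℝ)) := by
    rw [← Set.range_comp]
    congr 1
    ext1 i
    simp [Fintype.linearCombination_apply_single]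
  rw [h, ← LinearMap.image_convexHull, convexHull_rangle_single_eq_stdSimplex]
  simp only [Set.mem_image, Fintype.linearCombination_apply]
  rfl

theorem convexHull_range_eq_image {m d : ℕ} (p : Fin (m + 1) → EuclideanSpace ℝ (Fin d)) :
    convexHull ℝ (Set.range p) = simplexMap p '' corner m := by
  ext y
  simp only [mem_convexHull_range_iff, Set.mem_image, simplexMap_eq_sum_bary]
  constructor
  · rintro ⟨w, ⟨hw0, hw1⟩, rfl⟩
    rw [Fin.sum_univ_succ] at hw1
    have hb : bary (WithLp.toLp 2 (fun i : Fin m => w i.succ)) = w := by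
      funext i
      refine Fin.cases ?_ (fun j => ?_) i
      · simp [bary]; linarith
      · simp [bary]
    refine ⟨WithLp.toLp 2 (fun i : Fin m => w i.succ), ⟨fun i => hw0 _, ?_⟩, by rw [hb]⟩
    have := hw0 0
    simp only
    linarith
  · rintro ⟨x, hx, rfl⟩
    exact ⟨bary x, ⟨bary_nonneg hx, sum_bary x⟩, rfl⟩

theorem euclideanHausdorffMeasure_image_simplexMap {m d : ℕ}
    (p : Fin (m + 1) → EuclideanSpace ℝ (Fin d)) (s : Set (EuclideanSpace ℝ (Fin m))) :
    μHE[m] (simplexMap p '' s) = ENNReal.ofReal (linComb (edge p)).normDet * volume s := by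
  have h : simplexMap p '' s = (fun y => p 0 + y) '' (linComb (edge p) '' s) := by
    rw [Set.image_image]; rfl
  have h2 := LinearMap.euclideanHausdorffMeasure_image_eq_normDet_mul_volume (linComb (edge p)) s
  rw [finrank_euclideanSpace_fin] at h2
  rw [h, Isometry.euclideanHausdorffMeasure_image (isometry_add_left (p 0)), h2]

theorem normDet_linComb_sq {m d : ℕ} (u : Fin m → EuclideanSpace ℝ (Fin d)) :
    (linComb u).normDet ^ 2 = (Matrix.gram ℝ u).det := by
  have := LinearMap.normDet_sq_eq_det_gram (linComb u) (EuclideanSpace.basisFun (Fin m) ℝ)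
  simp only [RCLike.ofReal_real_eq_id, id] at this
  rw [this]
  congr 2
  funext i
  simp [linComb_apply]

theorem normDet_linComb_eq_abs_det {m : ℕ} (u : Fin m → EuclideanSpace ℝ (Fin m))
    (b : OrthonormalBasis (Fin m) ℝ (EuclideanSpace ℝ (Fin m))) :
    (linComb u).normDet = |(Matrix.of fun i j => ⟪b j, u i⟫).det| := by
  have h (A : Matrix (Fin m) (Fin m) ℝ) : A.det ^ 2 = (A * A.transpose).det := by
    rw [Matrix.det_mul, Matrix.det_transpose, sq]
  rw [← sq_eq_sq₀ (LinearMap.normDet_nonneg _) (abs_nonneg _), sq_abs, normDet_linComb_sq, h]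
  congr 1
  ext i j
  simp only [Matrix.gram_apply, Matrix.mul_apply, Matrix.of_apply, Matrix.transpose_apply]
  rw [← b.sum_inner_mul_inner (u i) (u j)]
  exact Finset.sum_congr rfl fun k _ => by rw [real_inner_comm (u i)]

theorem normDet_linComb_smul {m d : ℕ} (c : Fin m → ℝ) (u : Fin m → EuclideanSpace ℝ (Fin d)) :
    (linComb fun i => c i • u i).normDet = (∏ i, |c i|) * (linComb u).normDet := by
  rw [← sq_eq_sq₀ (LinearMap.normDet_nonneg _)
    (mul_nonneg (Finset.prod_nonneg fun _ _ => abs_nonneg _) (LinearMap.normDet_nonneg _)),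
    mul_pow, normDet_linComb_sq, normDet_linComb_sq]
  have : Matrix.gram ℝ (fun i => c i • u i)
      = Matrix.of fun i j => c i * (Matrix.of fun i j => c j * Matrix.gram ℝ u i j) i j := by
    ext i j
    simp [Matrix.gram_apply, inner_smul_left, inner_smul_right]
    ring
  rw [this, Matrix.det_mul_column, Matrix.det_mul_row, ← Finset.abs_prod, sq_abs]
  ring

theorem simplexMap_injective {m d : ℕ} {p : Fin (m + 1) → EuclideanSpace ℝ (Fin d)}
    (hp : (linComb (edge p)).normDet ≠ 0) : Function.Injective (simplexMap p) := by
  have := ((linComb (edge p)).normDet_ne_zero_tfae.out 0 4).mp hp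
  intro x y h
  exact this (add_left_cancel h)

theorem continuous_simplexMap {m d : ℕ} (p : Fin (m + 1) → EuclideanSpace ℝ (Fin d)) :
    Continuous (simplexMap p) :=
  continuous_const.add (linComb (edge p)).continuous_of_finiteDimensional

theorem measurableEmbedding_simplexMap {m d : ℕ} {p : Fin (m + 1) → EuclideanSpace ℝ (Fin d)}
    (hp : (linComb (edge p)).normDet ≠ 0) : MeasurableEmbedding (simplexMap p) :=
  (continuous_simplexMap p).measurableEmbedding (simplexMap_injective hp)

theorem continuous_coord {m : ℕ} (i : Fin m) : Continuous fun x : EuclideanSpace ℝ (Fin m) => x i :=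
  (EuclideanSpace.proj i).continuous

theorem isClosed_corner (m : ℕ) : IsClosed (corner m) := by
  have h : corner m = (⋂ i, {x : EuclideanSpace ℝ (Fin m) | 0 ≤ x i}) ∩ {x | ∑ i, x i ≤ 1} := by
    ext; simp [corner]
  rw [h]
  refine (isClosed_iInter fun i => isClosed_le continuous_const (continuous_coord i)).inter
    (isClosed_le (continuous_finsetSum _ fun i _ => continuous_coord i) continuous_const)

theorem measurableSet_corner (m : ℕ) : MeasurableSet (corner m) := (isClosed_corner m).measurableSet

/-- The constant volume factor of an affine map cancels on normalising, so uniform points of a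
simplex are images of uniform points of the corner. -/
theorem cond_image_simplexMap {m d : ℕ} {p : Fin (m + 1) → EuclideanSpace ℝ (Fin d)}
    (hp : (linComb (edge p)).normDet ≠ 0) {s : Set (EuclideanSpace ℝ (Fin m))}
    (hs : MeasurableSet s) :
    ProbabilityTheory.cond μHE[m] (simplexMap p '' s)
      = (ProbabilityTheory.cond volume s).map (simplexMap p) := by
  have he := measurableEmbedding_simplexMap hp
  have h0 : ENNReal.ofReal (linComb (edge p)).normDet ≠ 0 := by
    simpa using lt_of_le_of_ne (LinearMap.normDet_nonneg _) hp.symm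
  ext t ht
  rw [ProbabilityTheory.cond_apply (he.measurableSet_image.2 hs), he.map_apply,
    ProbabilityTheory.cond_apply hs, ← Set.image_inter_preimage,
    euclideanHausdorffMeasure_image_simplexMap, euclideanHausdorffMeasure_image_simplexMap,
    ENNReal.mul_inv (Or.inl h0) (Or.inl ENNReal.ofReal_ne_top), mul_mul_mul_comm,
    ENNReal.inv_mul_cancel h0 ENNReal.ofReal_ne_top, one_mul]

/-! ### Volume of the corner simplex and moments of barycentric coordinates -/

/-- Slicing at first coordinate `t` leaves a corner of size `r - t` in one dimension less; hence the
general `r` in the induction. -/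
theorem volume_pi_corner (m : ℕ) : ∀ r : ℝ, 0 ≤ r →
    volume {x : Fin m → ℝ | (∀ i, 0 ≤ x i) ∧ ∑ i, x i ≤ r}
      = ENNReal.ofReal (r ^ m / m.factorial) := by
  induction m with
  | zero =>
    intro r hr
    have : {x : Fin 0 → ℝ | (∀ i, 0 ≤ x i) ∧ ∑ i, x i ≤ r} = Set.univ := by
      ext; simp [hr]
    rw [this, volume_pi, Measure.pi_univ]
    simp
  | succ m ih =>
    intro r hr
    set S := {x : Fin (m + 1) → ℝ | (∀ i, 0 ≤ x i) ∧ ∑ i, x i ≤ r} with hS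
    let e := MeasurableEquiv.piFinSuccAbove (fun _ : Fin (m + 1) => ℝ) 0
    have he : MeasurePreserving e volume volume :=
      volume_preserving_piFinSuccAbove (fun _ : Fin (m + 1) => ℝ) 0
    have hSm : MeasurableSet S := by
      have h : S = (⋂ i, {x : Fin (m + 1) → ℝ | 0 ≤ x i}) ∩ {x | ∑ i, x i ≤ r} := by
        ext; simp [hS]
      rw [h]
      exact (MeasurableSet.iInter fun i => measurableSet_le measurable_const
        (measurable_pi_apply i)).inter (measurableSet_le (by fun_prop) measurable_const)
    rw [← he.symm.measure_preimage_equiv, Measure.volume_eq_prod,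
      Measure.prod_apply (e.symm.measurable hSm)]
    have hmem : ∀ (t : ℝ) (x : Fin m → ℝ),
        (t, x) ∈ e.symm ⁻¹' S ↔ (0 ≤ t ∧ ∀ i, 0 ≤ x i) ∧ t + ∑ i, x i ≤ r := by
      intro t x
      have : e.symm (t, x) = Fin.cons t x := Fin.insertNth_zero' t x
      rw [Set.mem_preimage, this, hS, Set.mem_ofPred_eq, Fin.forall_fin_succ, Fin.sum_univ_succ]
      simp
    have hslice : ∀ t : ℝ, volume (Prod.mk t ⁻¹' (e.symm ⁻¹' S))
        = (Set.Icc 0 r).indicator (fun t => ENNReal.ofReal ((r - t) ^ m / m.factorial)) t := by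
      intro t
      by_cases ht : t ∈ Set.Icc 0 r
      · rw [Set.indicator_of_mem ht, ← ih (r - t) (by linarith [ht.2])]
        congr 1
        ext x
        rw [Set.mem_preimage, hmem]
        simp [ht.1, le_sub_iff_add_le']
      · rw [Set.indicator_of_notMem ht]
        convert measure_empty (μ := (volume : Measure (Fin m → ℝ)))
        ext x
        simp only [Set.mem_preimage, hmem, Set.mem_empty_iff_false, iff_false]
        rintro ⟨⟨h0, h1⟩, h2⟩
        exact ht ⟨h0, by linarith [Finset.sum_nonneg fun i (_ : i ∈ Finset.univ) => h1 i]⟩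
    simp_rw [hslice]
    rw [lintegral_indicator measurableSet_Icc, ← ofReal_integral_eq_lintegral_ofReal]
    · rw [integral_Icc_eq_integral_Ioc, ← intervalIntegral.integral_of_le hr]
      congr 1
      rw [intervalIntegral.integral_comp_sub_left (fun x => x ^ m / (m.factorial : ℝ)) r]
      simp [integral_pow, Nat.factorial_succ]
      field_simp
    · exact ContinuousOn.integrableOn_Icc (by fun_prop)
    · filter_upwards [ae_restrict_mem measurableSet_Icc] with t ht
      have : 0 ≤ r - t := by linarith [ht.2]
      simp only [Pi.zero_apply]
      positivity

theorem volume_scaled_corner (m : ℕ) {r : ℝ} (hr : 0 ≤ r) :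
    volume {x : EuclideanSpace ℝ (Fin m) | (∀ i, 0 ≤ x i) ∧ ∑ i, x i ≤ r}
      = ENNReal.ofReal (r ^ m / m.factorial) := by
  rw [← volume_pi_corner m r hr,
    ← (EuclideanSpace.volume_preserving_symm_measurableEquiv_toLp (Fin m)).measure_preimage_equiv]
  rfl

theorem volume_corner (m : ℕ) : volume (corner m) = ENNReal.ofReal (1 / m.factorial) := by
  rw [corner, volume_scaled_corner m zero_le_one, one_pow]

theorem volume_real_corner (m : ℕ) : volume.real (corner m) = 1 / m.factorial := by
  rw [Measure.real, volume_corner, ENNReal.toReal_ofReal (by positivity)]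

theorem volume_corner_ne_zero (m : ℕ) : volume (corner m) ≠ 0 := by
  rw [volume_corner]
  simpa using Nat.factorial_ne_zero m

theorem volume_corner_ne_top (m : ℕ) : volume (corner m) ≠ ⊤ := by
  rw [volume_corner]
  exact ENNReal.ofReal_ne_top

instance (m : ℕ) : IsProbabilityMeasure (ProbabilityTheory.cond volume (corner m)) :=
  ProbabilityTheory.cond_isProbabilityMeasure_of_finite (volume_corner_ne_zero m)
    (volume_corner_ne_top m)

theorem continuous_bary {m : ℕ} (i : Fin (m + 1)) :
    Continuous fun x : EuclideanSpace ℝ (Fin m) => bary x i := by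
  refine Fin.cases ?_ (fun j => ?_) i
  · simp only [bary, Fin.cons_zero]
    exact continuous_const.sub (continuous_finsetSum _ fun i _ => continuous_coord i)
  · simpa [bary] using continuous_coord j

/-- Layer-cake formula: the part of the corner where `bary x 0 ≥ t` is a corner of size `1 - t`. -/
theorem setIntegral_corner_bary_zero_pow (m k : ℕ) (hk : k ≠ 0) :
    ∫ x in corner m, bary x 0 ^ k
      = k * ∫ t in (0 : ℝ)..1, (1 - t) ^ m / m.factorial * t ^ (k - 1) := by
  have hnn : 0 ≤ᵐ[volume.restrict (corner m)] fun x : EuclideanSpace ℝ (Fin m) => bary x 0 := by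
    filter_upwards [ae_restrict_mem (measurableSet_corner m)] with x hx using bary_nonneg hx 0
  have key := lintegral_rpow_eq_lintegral_meas_le_mul (volume.restrict (corner m)) hnn
    (continuous_bary 0).aemeasurable (p := k) (by positivity)
  have hrhs : ∀ t ∈ Set.Ioi (0 : ℝ),
      volume.restrict (corner m) {x : EuclideanSpace ℝ (Fin m) | t ≤ bary x 0}
        * ENNReal.ofReal (t ^ ((k : ℝ) - 1))
      = (Set.Iic 1).indicator
        (fun t => ENNReal.ofReal ((1 - t) ^ m / m.factorial * t ^ (k - 1))) t := by
    intro t ht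
    have ht0 : 0 < t := ht
    have hk1 : t ^ ((k : ℝ) - 1) = t ^ (k - 1) := by
      rw [← Real.rpow_natCast, Nat.cast_sub (Nat.one_le_iff_ne_zero.2 hk)]; simp
    rw [hk1, Measure.restrict_apply' (measurableSet_corner m)]
    by_cases h1 : t ≤ 1
    · rw [Set.indicator_of_mem (show t ∈ Set.Iic 1 from h1),
        ENNReal.ofReal_mul (by have : 0 ≤ 1 - t := by linarith
                               positivity), ← volume_scaled_corner m (sub_nonneg.2 h1)]
      congr 2
      ext x
      simp only [bary, corner, Fin.cons_zero, Set.mem_inter_iff, Set.mem_ofPred_eq]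
      constructor
      · rintro ⟨h, h2, -⟩
        exact ⟨h2, by linarith⟩
      · rintro ⟨h2, h⟩
        exact ⟨by linarith, h2, by linarith⟩
    · rw [Set.indicator_of_notMem (show t ∉ Set.Iic 1 from h1)]
      convert zero_mul _
      convert measure_empty (μ := (volume : Measure (EuclideanSpace ℝ (Fin m))))
      ext x
      simp only [bary, corner, Fin.cons_zero, Set.mem_inter_iff, Set.mem_ofPred_eq,
        Set.mem_empty_iff_false, iff_false]
      rintro ⟨h, h2, -⟩
      linarith [Finset.sum_nonneg fun i (_ : i ∈ Finset.univ) => h2 i]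
  rw [setLIntegral_congr_fun measurableSet_Ioi hrhs, setLIntegral_indicator measurableSet_Iic,
    Set.Iic_inter_Ioi,
    ← ofReal_integral_eq_lintegral_ofReal (μ := volume.restrict (Set.Ioc (0 : ℝ) 1)),
    ← ENNReal.ofReal_mul (by positivity), ← intervalIntegral.integral_of_le zero_le_one] at key
  · simp_rw [Real.rpow_natCast] at key
    rw [integral_eq_lintegral_of_nonneg_ae, key, ENNReal.toReal_ofReal]
    · refine mul_nonneg (by positivity) (intervalIntegral.integral_nonneg zero_le_one ?_)
      intro t ht
      have : 0 ≤ 1 - t := by linarith [ht.2]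
      have := ht.1
      positivity
    · filter_upwards [hnn] with x hx using pow_nonneg hx k
    · exact ((continuous_bary 0).pow k).aestronglyMeasurable
  · exact (ContinuousOn.integrableOn_Icc (by fun_prop)).mono_set Set.Ioc_subset_Icc_self
  · filter_upwards [ae_restrict_mem measurableSet_Ioc] with t ht
    have : 0 ≤ 1 - t := by linarith [ht.2]
    have := ht.1
    simp only [Pi.zero_apply]
    positivity

theorem integral_cond_corner {m : ℕ} (f : EuclideanSpace ℝ (Fin m) → ℝ) :
    ∫ x, f x ∂(ProbabilityTheory.cond volume (corner m))
      = m.factorial * ∫ x in corner m, f x := by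
  rw [ProbabilityTheory.cond, integral_smul_measure, ENNReal.toReal_inv]
  change (volume.real (corner m))⁻¹ • _ = _
  rw [volume_real_corner]
  simp

theorem expect_bary_zero (m : ℕ) :
    ∫ x, bary x 0 ∂(ProbabilityTheory.cond volume (corner m)) = 1 / ((m : ℝ) + 1) := by
  have h := setIntegral_corner_bary_zero_pow m 1 one_ne_zero
  simp only [pow_one, Nat.sub_self, pow_zero, mul_one] at h
  rw [integral_cond_corner, h,
    intervalIntegral.integral_comp_sub_left (fun x => x ^ m / (m.factorial : ℝ)) 1]
  simp [integral_pow]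
  field_simp

theorem expect_bary_zero_sq (m : ℕ) :
    ∫ x, bary x 0 ^ 2 ∂(ProbabilityTheory.cond volume (corner m))
      = 2 / (((m : ℝ) + 1) * (m + 2)) := by
  have h := setIntegral_corner_bary_zero_pow m 2 two_ne_zero
  have h2 := intervalIntegral.integral_comp_sub_left (a := 0) (b := 1)
    (fun x : ℝ => x ^ m / (m.factorial : ℝ) * (1 - x)) 1
  have h3 : ∀ x : ℝ, x ^ m / (m.factorial : ℝ) * (1 - x)
      = (m.factorial : ℝ)⁻¹ * (x ^ m - x ^ (m + 1)) := fun x => by ring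
  simp only [sub_sub_cancel, sub_zero, sub_self] at h2
  simp only [pow_one, show 2 - 1 = 1 from rfl] at h
  rw [integral_cond_corner, h, h2]
  simp_rw [h3]
  rw [intervalIntegral.integral_const_mul, intervalIntegral.integral_sub (by simp) (by simp),
    integral_pow, integral_pow]
  push_cast
  simp
  field_simp
  ring

/-- The vertices of the corner simplex. -/
noncomputable def cornerVertex {m : ℕ} : Fin (m + 1) → EuclideanSpace ℝ (Fin m) :=
  Fin.cons 0 fun i => EuclideanSpace.single i 1

theorem bary_cornerVertex_sum {m : ℕ} (w : Fin (m + 1) → ℝ) (hw : ∑ i, w i = 1) :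
    bary (∑ i, w i • cornerVertex i) = w := by
  have h (j : Fin m) : (∑ i, w i • cornerVertex i : EuclideanSpace ℝ (Fin m)) j = w j.succ := by
    simp [Fin.sum_univ_succ, cornerVertex, Finset.sum_apply, Pi.single_apply]
  funext i
  refine Fin.cases ?_ (fun j => ?_) i
  · simp only [bary, Fin.cons_zero, h]
    rw [Fin.sum_univ_succ] at hw
    linarith
  · simp only [bary, Fin.cons_succ, h]

theorem linComb_edge_cornerVertex (m : ℕ) :
    linComb (edge (cornerVertex (m := m))) = LinearMap.id := by
  ext x j
  rw [linComb_apply]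
  simp [edge, cornerVertex, Finset.sum_apply, Pi.single_apply]

theorem convexHull_cornerVertex (m : ℕ) :
    convexHull ℝ (Set.range (cornerVertex (m := m))) = corner m := by
  rw [convexHull_range_eq_image]
  have : simplexMap (cornerVertex (m := m)) = id := by
    funext x
    rw [simplexMap, linComb_edge_cornerVertex]
    simp [cornerVertex]
  rw [this, Set.image_id]

/-- Permuting the vertices is an affine bijection of the corner onto itself, and so preserves its
uniform law. -/
theorem expect_bary_perm {m : ℕ} (σ : Equiv.Perm (Fin (m + 1))) (g : (Fin (m + 1) → ℝ) → ℝ) :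
    ∫ x, g (bary x ∘ σ) ∂(ProbabilityTheory.cond volume (corner m))
      = ∫ x, g (bary x) ∂(ProbabilityTheory.cond volume (corner m)) := by
  set p : Fin (m + 1) → EuclideanSpace ℝ (Fin m) := cornerVertex ∘ σ.symm with hp
  have himg : simplexMap p '' corner m = corner m := by
    rw [← convexHull_range_eq_image, hp, σ.symm.surjective.range_comp, convexHull_cornerVertex]
  have hvol := euclideanHausdorffMeasure_image_simplexMap p (corner m)
  rw [himg, EuclideanSpace.euclideanHausdorffMeasure_eq_volume] at hvol
  have hdet : (linComb (edge p)).normDet ≠ 0 := by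
    intro h
    rw [h, ENNReal.ofReal_zero, zero_mul] at hvol
    exact volume_corner_ne_zero m hvol
  have hc := cond_image_simplexMap hdet (measurableSet_corner m)
  rw [himg, EuclideanSpace.euclideanHausdorffMeasure_eq_volume] at hc
  conv_rhs => rw [hc]
  rw [(measurableEmbedding_simplexMap hdet).integral_map]
  congr 1
  funext x
  congr 1
  rw [simplexMap_eq_sum_bary, hp, ← Equiv.sum_comp σ]
  simp only [Function.comp_apply, Equiv.symm_apply_apply]
  rw [bary_cornerVertex_sum (fun i => bary x (σ i)) (by rw [Equiv.sum_comp σ, sum_bary])]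
  rfl

theorem integrableOn_corner {m : ℕ} {f : EuclideanSpace ℝ (Fin m) → ℝ} (hf : Continuous f) :
    IntegrableOn f (corner m) := by
  have hc : IsCompact (corner m) := by
    rw [← convexHull_cornerVertex]
    exact (Set.finite_range _).isCompact_convexHull ℝ
  exact hf.continuousOn.integrableOn_compact hc

theorem integrable_cond_corner {m : ℕ} {f : EuclideanSpace ℝ (Fin m) → ℝ} (hf : Continuous f) :
    Integrable f (ProbabilityTheory.cond volume (corner m)) :=
  (integrableOn_corner hf).smul_measure (ENNReal.inv_ne_top.2 (volume_corner_ne_zero m))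

theorem expect_bary {m : ℕ} (i : Fin (m + 1)) :
    ∫ x, bary x i ∂(ProbabilityTheory.cond volume (corner m)) = 1 / ((m : ℝ) + 1) := by
  rw [← expect_bary_zero, ← expect_bary_perm (Equiv.swap 0 i) fun w => w 0]
  simp

theorem expect_bary_sq {m : ℕ} (i : Fin (m + 1)) :
    ∫ x, bary x i ^ 2 ∂(ProbabilityTheory.cond volume (corner m))
      = 2 / (((m : ℝ) + 1) * (m + 2)) := by
  rw [← expect_bary_zero_sq, ← expect_bary_perm (Equiv.swap 0 i) fun w => w 0 ^ 2]
  simp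

/-- By symmetry all mixed moments with `i` agree, and since the coordinates sum to `1`, the first
moment is the second moment plus `m` mixed ones. -/
theorem expect_bary_mul_of_ne {m : ℕ} {i j : Fin (m + 1)} (hij : i ≠ j) :
    ∫ x, bary x i * bary x j ∂(ProbabilityTheory.cond volume (corner m))
      = 1 / (((m : ℝ) + 1) * (m + 2)) := by
  have hsym : ∀ k ∈ Finset.univ.erase i,
      ∫ x, bary x i * bary x k ∂(ProbabilityTheory.cond volume (corner m))
        = ∫ x, bary x i * bary x j ∂(ProbabilityTheory.cond volume (corner m)) := by
    intro k hk
    rw [← expect_bary_perm (Equiv.swap j k) fun w => w i * w j]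
    simp [Equiv.swap_apply_of_ne_of_ne hij (Finset.ne_of_mem_erase hk).symm]
  have hsum : ∑ k, ∫ x, bary x i * bary x k ∂(ProbabilityTheory.cond volume (corner m))
      = 1 / ((m : ℝ) + 1) := by
    have hint (k : Fin (m + 1)) : Integrable (fun x => bary x i * bary x k)
        (ProbabilityTheory.cond volume (corner m)) :=
      integrable_cond_corner ((continuous_bary i).mul (continuous_bary k))
    rw [← integral_finsetSum _ fun k _ => hint k, ← expect_bary i]
    simp_rw [← Finset.mul_sum, sum_bary, mul_one]
  rw [← Finset.add_sum_erase _ _ (Finset.mem_univ i), Finset.sum_congr rfl hsym,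
    Finset.sum_const, Finset.card_erase_of_mem (Finset.mem_univ i), Finset.card_univ,
    Fintype.card_fin] at hsum
  simp_rw [← sq, expect_bary_sq] at hsum
  -- Two distinct indices in `Fin (m + 1)` force `m ≠ 0`, which allows division by the number of
  -- mixed terms.
  have hm : (m : ℝ) ≠ 0 := by
    rintro h
    have : m = 0 := by exact_mod_cast h
    subst this
    exact hij (Subsingleton.elim (α := Fin 1) _ _)
  rw [Nat.add_sub_cancel, nsmul_eq_mul] at hsum
  refine mul_left_cancel₀ hm ?_
  rw [eq_sub_of_add_eq' hsum]
  field_simp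
  ring

/-! ### Expected squared determinant and the second moment of a simplex -/

/-- Expand the square over pairs `σ, τ`; independence factors each term. For fixed `σ` the sum over
`τ` is the moment determinant with permuted rows, and the two signs of `σ` cancel, so all `n!`
choices contribute equally. -/
theorem integral_det_sq {n : ℕ} {X : Type*} [MeasurableSpace X] (μ : Measure X)
    [IsProbabilityMeasure μ] (f : X → Fin n → ℝ)
    (hf : ∀ i j, Integrable (fun x => f x i * f x j) μ) :
    ∫ x : Fin n → X, (Matrix.of fun i j => f (x i) j).det ^ 2 ∂(Measure.pi fun _ => μ)
      = n.factorial * (Matrix.of fun i j => ∫ x, f x i * f x j ∂μ).det := by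
  have hexp (x : Fin n → X) : (Matrix.of fun i j => f (x i) j).det ^ 2
      = ∑ σ : Equiv.Perm (Fin n), ∑ τ : Equiv.Perm (Fin n),
        (((Equiv.Perm.sign σ : ℤ) : ℝ) * ((Equiv.Perm.sign τ : ℤ) : ℝ))
          * ∏ i, (f (x i) (σ i) * f (x i) (τ i)) := by
    rw [sq, ← Matrix.det_transpose, Matrix.det_apply', Finset.sum_mul_sum]
    refine Finset.sum_congr rfl fun σ _ => Finset.sum_congr rfl fun τ _ => ?_
    simp only [Matrix.transpose_apply, Matrix.of_apply, Finset.prod_mul_distrib]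
    ring
  have hint (σ τ : Equiv.Perm (Fin n)) : Integrable
      (fun x : Fin n → X => (((Equiv.Perm.sign σ : ℤ) : ℝ) * ((Equiv.Perm.sign τ : ℤ) : ℝ))
          * ∏ i, (f (x i) (σ i) * f (x i) (τ i))) (Measure.pi fun _ => μ) :=
    (Integrable.fintype_prod (f := fun i x => f x (σ i) * f x (τ i))
      fun i => hf (σ i) (τ i)).const_mul _
  simp_rw [hexp]
  rw [integral_finsetSum _ fun σ _ => integrable_finsetSum _ fun τ _ => hint σ τ]
  have hterm (σ : Equiv.Perm (Fin n)) :
      ∫ x : Fin n → X, ∑ τ : Equiv.Perm (Fin n),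
        (((Equiv.Perm.sign σ : ℤ) : ℝ) * ((Equiv.Perm.sign τ : ℤ) : ℝ))
          * ∏ i, (f (x i) (σ i) * f (x i) (τ i)) ∂(Measure.pi fun _ => μ)
        = (Matrix.of fun i j => ∫ x, f x i * f x j ∂μ).det := by
    rw [integral_finsetSum _ fun τ _ => hint σ τ]
    have h1 := Matrix.det_permute σ (Matrix.of fun i j => ∫ x, f x i * f x j ∂μ)
    have h2 : ((Equiv.Perm.sign σ : ℤ) : ℝ) * ((Equiv.Perm.sign σ : ℤ) : ℝ) = 1 := by
      rw [← Int.cast_mul, ← Units.val_mul, Int.units_mul_self]; simp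
    rw [← Matrix.det_transpose, Matrix.det_apply'] at h1
    simp only [Matrix.transpose_apply, Matrix.submatrix_apply, Matrix.of_apply, id] at h1
    rw [← one_mul (Matrix.det _), ← h2, mul_assoc, ← h1, Finset.mul_sum]
    refine Finset.sum_congr rfl fun τ _ => ?_
    rw [integral_const_mul,
      integral_fintype_prod_eq_prod (f := fun i x => f x (σ i) * f x (τ i)), mul_assoc]
  simp_rw [hterm]
  simp [Finset.card_univ, Fintype.card_perm]

theorem normDet_linComb_edge {m : ℕ} (y : Fin (m + 1) → EuclideanSpace ℝ (Fin m)) :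
    (linComb (edge y)).normDet = |(Matrix.of fun i j => bary (y i) j).det| := by
  rw [normDet_linComb_eq_abs_det _ (EuclideanSpace.basisFun (Fin m) ℝ)]
  congr 1
  -- Adding all columns to column `0` turns it into ones; subtracting row `0` from the others then
  -- leaves the edge vectors as a minor.
  have h1 := Matrix.det_updateCol_sum (Matrix.of fun i j => bary (y i) j) 0 (fun _ => 1)
  simp only [Matrix.of_apply, one_smul, sum_bary] at h1
  rw [← h1]
  let B : Matrix (Fin (m + 1)) (Fin (m + 1)) ℝ := Matrix.of
    (Fin.cons (Fin.cons 1 (y 0)) fun i => Fin.cons 0 (edge y i))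
  rw [Matrix.det_eq_of_forall_row_eq_smul_add_const (B := B) (Fin.cons 0 fun _ => 1) 0 rfl]
  · rw [Matrix.det_succ_column_zero, Fin.sum_univ_succ]
    simp [B]
    congr 1
    ext i j
    simp [EuclideanSpace.inner_single_left]
  · intro i j
    refine Fin.cases ?_ (fun i => ?_) i <;> refine Fin.cases ?_ (fun j => ?_) j <;>
      simp [B, edge, bary]

/-- The diagonal moments are twice the others, so the matrix is a scalar times identity plus
all-ones, and the latter sum has determinant `1 + (m + 1)`. -/
theorem det_bary_moments (m : ℕ) :
    (Matrix.of fun i j : Fin (m + 1) =>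
        ∫ x, bary x i * bary x j ∂(ProbabilityTheory.cond volume (corner m))).det
      = (1 / (((m : ℝ) + 1) * (m + 2))) ^ (m + 1) * (m + 2) := by
  have h : (Matrix.of fun i j : Fin (m + 1) =>
        ∫ x, bary x i * bary x j ∂(ProbabilityTheory.cond volume (corner m)))
      = (1 / (((m : ℝ) + 1) * (m + 2))) • (1 + Matrix.replicateCol Unit (fun _ => (1 : ℝ))
          * Matrix.replicateRow Unit (fun _ => (1 : ℝ))) := by
    ext i j
    simp only [Matrix.of_apply, Matrix.smul_apply, Matrix.add_apply, Matrix.mul_apply,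
      Matrix.replicateCol_apply, Matrix.replicateRow_apply, smul_eq_mul]
    rcases eq_or_ne i j with rfl | hij
    · simp_rw [← sq, expect_bary_sq]
      simp only [Matrix.one_apply_eq, Finset.univ_unique, Finset.sum_const, Finset.card_singleton,
        one_smul]
      ring
    · rw [expect_bary_mul_of_ne hij]
      simp [hij]
  rw [h, Matrix.det_smul, Matrix.det_one_add_replicateCol_mul_replicateRow]
  simp only [dotProduct, mul_one, Finset.sum_const, Finset.card_univ, Fintype.card_fin,
    nsmul_eq_mul]
  push_cast
  ring

theorem simplexMap_comp {m d n : ℕ} (p : Fin (m + 1) → EuclideanSpace ℝ (Fin d))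
    (y : Fin (n + 1) → EuclideanSpace ℝ (Fin m)) (x : EuclideanSpace ℝ (Fin n)) :
    simplexMap (fun i => simplexMap p (y i)) x = simplexMap p (simplexMap y x) := by
  simp [simplexMap, linComb_apply (edge _) x, edge, map_sum, add_assoc]

theorem metricMoment_simplex {m d : ℕ} (p : Fin (m + 1) → EuclideanSpace ℝ (Fin d))
    (hp : (linComb (edge p)).normDet ≠ 0) :
    metricMoment m m 2 (convexHull ℝ (Set.range p))
      = m.factorial / (((m : ℝ) + 1) ^ m * ((m : ℝ) + 2) ^ m) := by
  -- Being an embedding allows the change of variables without any measurability of the integrand.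
  have hemb : MeasurableEmbedding
      fun (y : Fin (m + 1) → EuclideanSpace ℝ (Fin m)) i => simplexMap p (y i) := by
    refine Continuous.measurableEmbedding ?_ ?_
    · exact continuous_pi fun i => (continuous_simplexMap p).comp (continuous_apply i)
    · intro y z h
      funext i
      exact simplexMap_injective hp (congrFun h i)
  have hvol (y : Fin (m + 1) → EuclideanSpace ℝ (Fin m)) :
      μHE[m].real (convexHull ℝ (Set.range fun i => simplexMap p (y i)))
        = (linComb (edge p)).normDet
          * ((linComb (edge y)).normDet * volume.real (corner m)) := by
    have : simplexMap (fun i => simplexMap p (y i)) '' corner m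
        = simplexMap p '' (simplexMap y '' corner m) := by
      rw [Set.image_image]
      simp_rw [simplexMap_comp]
    have h2 := euclideanHausdorffMeasure_image_simplexMap y (corner m)
    rw [EuclideanSpace.euclideanHausdorffMeasure_eq_volume] at h2
    rw [convexHull_range_eq_image, this, Measure.real, euclideanHausdorffMeasure_image_simplexMap,
      h2, ENNReal.toReal_mul, ENNReal.toReal_mul,
      ENNReal.toReal_ofReal (LinearMap.normDet_nonneg _),
      ENNReal.toReal_ofReal (LinearMap.normDet_nonneg _), Measure.real]
  have hK : μHE[m].real (simplexMap p '' corner m)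
      = (linComb (edge p)).normDet * volume.real (corner m) := by
    rw [Measure.real, euclideanHausdorffMeasure_image_simplexMap, ENNReal.toReal_mul,
      ENNReal.toReal_ofReal (LinearMap.normDet_nonneg _), Measure.real]
  have hc : volume.real (corner m) ≠ 0 := by
    rw [volume_real_corner]
    positivity
  rw [metricMoment, convexHull_range_eq_image p, cond_image_simplexMap hp (measurableSet_corner m),
    hK]
  have hpi := Measure.pi_map_pi (μ := fun _ : Fin (m + 1) =>
    ProbabilityTheory.cond volume (corner m)) (f := fun _ => simplexMap p)
    (hμ := fun _ => by
      have := Measure.isProbabilityMeasure_map (μ := ProbabilityTheory.cond volume (corner m))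
        (continuous_simplexMap p).aemeasurable
      infer_instance) fun _ => (continuous_simplexMap p).aemeasurable
  rw [← hpi, hemb.integral_map, ← integral_div]
  simp_rw [hvol]
  have hfun (y : Fin (m + 1) → EuclideanSpace ℝ (Fin m)) :
      ((linComb (edge p)).normDet * ((linComb (edge y)).normDet * volume.real (corner m))) ^ 2
        / ((linComb (edge p)).normDet * volume.real (corner m)) ^ 2
      = (Matrix.of fun i j => bary (y i) j).det ^ 2 := by
    rw [← sq_abs (Matrix.det _), ← normDet_linComb_edge]
    field_simp
  simp_rw [hfun]
  rw [integral_det_sq _ bary fun i j =>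
    integrable_cond_corner ((continuous_bary i).mul (continuous_bary j)), det_bary_moments,
    Nat.factorial_succ]
  push_cast
  rw [one_div_pow, mul_pow, pow_succ ((m : ℝ) + 1), pow_succ ((m : ℝ) + 2)]
  field_simp

/-! ### The section near a vertex: its shape, volume and `iota` -/

/-- The point in which the edge from `p 0` to `p j.succ` is divided in the ratio `(u j)⁻¹`. -/
noncomputable def cutPoint {m d : ℕ} (p : Fin (m + 1) → EuclideanSpace ℝ (Fin d)) (u : Fin m → ℝ)
    (j : Fin m) : EuclideanSpace ℝ (Fin d) := p 0 + (u j)⁻¹ • edge p j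

/-- In edge coordinates the hyperplane is `∑ x_j u_j = 1`, and `u_j > 1` makes `∑ x_j ≤ 1`
automatic. The sign of `s` is free, so both sides of the separation are covered. -/
theorem hyperplane_inter_convexHull {m d : ℕ} {p : Fin (m + 1) → EuclideanSpace ℝ (Fin d)}
    {η : EuclideanSpace ℝ (Fin d)} {s : ℝ} {u : Fin m → ℝ} (hs : s ≠ 0)
    (hv : ⟪η, p 0⟫ = 1 - s) (hw : ∀ j, ⟪η, edge p j⟫ = s * u j) (hu : ∀ j, 1 < u j) :
    hyperplane η ∩ convexHull ℝ (Set.range p) = convexHull ℝ (Set.range (cutPoint p u)) := by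
  have hu0 (j : Fin m) : 0 < u j := one_pos.trans (hu j)
  have hin (x : EuclideanSpace ℝ (Fin m)) :
      ⟪η, simplexMap p x⟫ = 1 - s + s * ∑ j, x j * u j := by
    simp only [simplexMap, linComb_apply, inner_add_right, inner_sum, inner_smul_right, hv, hw,
      Finset.mul_sum]
    congr 1
    exact Finset.sum_congr rfl fun j _ => by ring
  ext y
  rw [convexHull_range_eq_image, mem_convexHull_range_iff]
  constructor
  · rintro ⟨hy, x, hx, rfl⟩
    have h1 : ∑ j, x j * u j = 1 := by
      have h2 : ⟪η, simplexMap p x⟫ = 1 := hy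
      rw [hin] at h2
      exact mul_left_cancel₀ hs (by linarith)
    refine ⟨fun j => x j * u j, ⟨fun j => mul_nonneg (hx.1 j) (hu0 j).le, h1⟩, ?_⟩
    simp only [cutPoint, smul_add, Finset.sum_add_distrib, ← Finset.sum_smul, h1, one_smul,
      simplexMap, linComb_apply, smul_smul]
    congr 1
    exact Finset.sum_congr rfl fun j _ => by rw [mul_assoc, mul_inv_cancel₀ (hu0 j).ne', mul_one]
  · rintro ⟨w, ⟨hw0, hw1⟩, rfl⟩
    have hy : ∑ i, w i • cutPoint p u i
        = simplexMap p (WithLp.toLp 2 fun j => w j * (u j)⁻¹) := by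
      simp only [cutPoint, smul_add, Finset.sum_add_distrib, ← Finset.sum_smul, hw1, one_smul,
        simplexMap, linComb_apply, smul_smul]
    rw [hy]
    refine ⟨?_, _, ⟨fun j => mul_nonneg (hw0 j) (inv_nonneg.2 (hu0 j).le), ?_⟩, rfl⟩
    · change ⟪η, _⟫ = 1
      rw [hin]
      have : ∑ j, w j * (u j)⁻¹ * u j = 1 := by
        rw [← hw1]
        exact Finset.sum_congr rfl fun j _ => by
          rw [mul_assoc, inv_mul_cancel₀ (hu0 j).ne', mul_one]
      simp only [this]
      ring
    · rw [← hw1]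
      exact Finset.sum_le_sum fun j _ =>
        mul_le_of_le_one_right (hw0 j) (inv_le_one_of_one_le₀ (hu j).le)

/-- Volume of a pyramid with apex `v`: the base lies in a hyperplane normal to `η`, at distance `|s|
/ ‖η‖` from the apex. -/
theorem normDet_mul_of_inner_eq {m : ℕ} {q : Fin (m + 1) → EuclideanSpace ℝ (Fin (m + 1))}
    {η v : EuclideanSpace ℝ (Fin (m + 1))} {s : ℝ} (hη : η ≠ 0)
    (hq : ∀ j, ⟪η, q j - v⟫ = s) :
    (linComb fun j => q j - v).normDet * ‖η‖ = |s| * (linComb (edge q)).normDet := by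
  have hη' : ‖η‖ ≠ 0 := norm_ne_zero_iff.2 hη
  -- In an orthonormal basis starting with the unit normal, the edges of the base have zero first
  -- coordinate.
  obtain ⟨b, hb⟩ := Orthonormal.exists_orthonormalBasis_extension_of_card_eq (𝕜 := ℝ)
    (E := EuclideanSpace ℝ (Fin (m + 1))) (ι := Fin (m + 1)) (by simp)
    (v := fun _ => ‖η‖⁻¹ • η) (s := {0}) (by
      rw [orthonormal_iff_ite]
      rintro ⟨i, hi⟩ ⟨j, hj⟩
      obtain rfl : i = 0 := hi
      obtain rfl : j = 0 := hj
      simp [Set.domRestrict, norm_smul, hη'])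
  have hb0 : b 0 = ‖η‖⁻¹ • η := hb 0 rfl
  have hbq (j : Fin (m + 1)) : ⟪b 0, q j - v⟫ = ‖η‖⁻¹ * s := by
    rw [hb0, real_inner_smul_left, hq]
  have hbe (j : Fin m) : ⟪b 0, edge q j⟫ = 0 := by
    have : edge q j = (q j.succ - v) - (q 0 - v) := by simp [edge]
    rw [this, inner_sub_right, hbq, hbq, sub_self]
  set N : Matrix (Fin m) (Fin m) ℝ := Matrix.of fun i j => ⟪b j.succ, edge q i⟫ with hN
  have hNdet : (linComb (edge q)).normDet = |N.det| := by
    have h : Matrix.gram ℝ (edge q) = N * N.transpose := by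
      ext i j
      simp only [Matrix.gram_apply, Matrix.mul_apply, hN, Matrix.of_apply, Matrix.transpose_apply]
      rw [← b.sum_inner_mul_inner (edge q i) (edge q j), Fin.sum_univ_succ, hbe, mul_zero, zero_add]
      exact Finset.sum_congr rfl fun k _ => by rw [real_inner_comm (edge q i)]
    rw [← sq_eq_sq₀ (LinearMap.normDet_nonneg _) (abs_nonneg _), sq_abs, normDet_linComb_sq, h,
      Matrix.det_mul, Matrix.det_transpose, sq]
  have hA : (Matrix.of fun i j => ⟪b j, q i - v⟫ : Matrix (Fin (m + 1)) (Fin (m + 1)) ℝ).det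
      = ‖η‖⁻¹ * s * N.det := by
    let B : Matrix (Fin (m + 1)) (Fin (m + 1)) ℝ := Matrix.of
      (Fin.cons (fun j => ⟪b j, q 0 - v⟫) fun i j => ⟪b j, edge q i⟫)
    rw [Matrix.det_eq_of_forall_row_eq_smul_add_const (B := B) (Fin.cons 0 fun _ => 1) 0 rfl]
    · rw [Matrix.det_succ_column_zero, Fin.sum_univ_succ]
      simp [B, hbe, hbq, -mul_eq_mul_left_iff]
      congr 1
    · intro i j
      refine Fin.cases ?_ (fun i => ?_) i <;> simp [B, edge, ← inner_add_right]
  rw [normDet_linComb_eq_abs_det _ b, hA, hNdet, abs_mul, abs_mul, abs_inv, abs_norm]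
  field_simp

theorem restrict_image_simplexMap {m : ℕ} {p : Fin (m + 1) → EuclideanSpace ℝ (Fin m)}
    (hp : (linComb (edge p)).normDet ≠ 0) {s : Set (EuclideanSpace ℝ (Fin m))}
    (hs : MeasurableSet s) :
    volume.restrict (simplexMap p '' s)
      = ENNReal.ofReal (linComb (edge p)).normDet • (volume.restrict s).map (simplexMap p) := by
  have he := measurableEmbedding_simplexMap hp
  ext t ht
  rw [Measure.smul_apply, he.map_apply, Measure.restrict_apply' (he.measurableSet_image.2 hs),
    Measure.restrict_apply' hs, ← Set.image_preimage_inter,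
    ← EuclideanSpace.euclideanHausdorffMeasure_eq_volume,
    euclideanHausdorffMeasure_image_simplexMap, smul_eq_mul,
    EuclideanSpace.euclideanHausdorffMeasure_eq_volume]

theorem setIntegral_image_simplexMap {m : ℕ} {p : Fin (m + 1) → EuclideanSpace ℝ (Fin m)}
    (hp : (linComb (edge p)).normDet ≠ 0) {s : Set (EuclideanSpace ℝ (Fin m))}
    (hs : MeasurableSet s) (f : EuclideanSpace ℝ (Fin m) → ℝ) :
    ∫ x in simplexMap p '' s, f x
      = (linComb (edge p)).normDet * ∫ x in s, f (simplexMap p x) := by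
  rw [restrict_image_simplexMap hp hs, integral_smul_measure,
    (measurableEmbedding_simplexMap hp).integral_map,
    ENNReal.toReal_ofReal (LinearMap.normDet_nonneg _), smul_eq_mul]

theorem setIntegral_corner_eq {m : ℕ} (f : EuclideanSpace ℝ (Fin m) → ℝ) :
    ∫ x in corner m, f x
      = (m.factorial : ℝ)⁻¹ * ∫ x, f x ∂(ProbabilityTheory.cond volume (corner m)) := by
  rw [integral_cond_corner]
  field_simp

theorem setIntegral_corner_coord {m : ℕ} (j : Fin m) :
    ∫ x in corner m, x j = (m.factorial : ℝ)⁻¹ * (1 / ((m : ℝ) + 1)) := by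
  rw [setIntegral_corner_eq, ← expect_bary j.succ]
  rfl

/-- The integrand lives on the smaller simplex with vertices `0` and `(u j)⁻¹` on the axes.
Rescaling this to the corner turns the integrand into `bary x 0`. -/
theorem setIntegral_corner_posPart {m : ℕ} {u : Fin m → ℝ} (hu : ∀ j, 1 < u j) :
    ∫ x in corner m, max (1 - ∑ j, u j * x j) 0
      = (∏ j, u j)⁻¹ * ((m.factorial : ℝ)⁻¹ * (1 / ((m : ℝ) + 1))) := by
  have hu0 (j : Fin m) : 0 < u j := one_pos.trans (hu j)
  set p : Fin (m + 1) → EuclideanSpace ℝ (Fin m) :=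
    Fin.cons 0 fun j => (u j)⁻¹ • EuclideanSpace.single j (1 : ℝ) with hp
  have hedge : edge p = fun j => (u j)⁻¹ • edge cornerVertex j := by
    funext j
    simp [edge, hp, cornerVertex]
  have hdet : (linComb (edge p)).normDet = (∏ j, u j)⁻¹ := by
    rw [hedge, normDet_linComb_smul, linComb_edge_cornerVertex, LinearMap.normDet_id, mul_one,
      ← Finset.prod_inv_distrib]
    exact Finset.prod_congr rfl fun j _ => abs_of_pos (inv_pos.2 (hu0 j))
  have hmap (x : EuclideanSpace ℝ (Fin m)) (j : Fin m) : simplexMap p x j = (u j)⁻¹ * x j := by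
    rw [simplexMap, linComb_apply]
    simp [hp, edge, Finset.sum_apply, Pi.single_apply, mul_comm]
  have hsum (x : EuclideanSpace ℝ (Fin m)) : ∑ j, u j * simplexMap p x j = ∑ j, x j :=
    Finset.sum_congr rfl fun j _ => by rw [hmap, mul_inv_cancel_left₀ (hu0 j).ne']
  have himg : simplexMap p '' corner m = corner m ∩ {x | ∑ j, u j * x j ≤ 1} := by
    ext y
    constructor
    · rintro ⟨x, hx, rfl⟩
      have hnn (j : Fin m) : 0 ≤ simplexMap p x j := by
        rw [hmap]
        exact mul_nonneg (inv_nonneg.2 (hu0 j).le) (hx.1 j)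
      have h1 : ∑ j, u j * simplexMap p x j ≤ 1 := (hsum x).trans_le hx.2
      refine ⟨⟨hnn, le_trans (Finset.sum_le_sum fun j _ => ?_) h1⟩, h1⟩
      exact le_mul_of_one_le_left (hnn j) (hu j).le
    · rintro ⟨hy, h1⟩
      refine ⟨WithLp.toLp 2 fun j => u j * y j, ⟨fun j => mul_nonneg (hu0 j).le (hy.1 j), h1⟩, ?_⟩
      ext j
      rw [hmap, inv_mul_cancel_left₀ (hu0 j).ne']
  have hmeas : MeasurableSet {x : EuclideanSpace ℝ (Fin m) | ∑ j, u j * x j ≤ 1} :=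
    (isClosed_le (continuous_finsetSum _ fun j _ => continuous_const.mul (continuous_coord j))
      continuous_const).measurableSet
  have hind : (fun x : EuclideanSpace ℝ (Fin m) => max (1 - ∑ j, u j * x j) 0)
      = Set.indicator {x | ∑ j, u j * x j ≤ 1} fun x => 1 - ∑ j, u j * x j := by
    funext x
    by_cases hx : ∑ j, u j * x j ≤ 1
    · rw [Set.indicator_of_mem (by exact hx), max_eq_left (sub_nonneg.2 hx)]
    · rw [Set.indicator_of_notMem (by exact hx), max_eq_right (by linarith)]
  rw [hind, setIntegral_indicator hmeas, ← himg, setIntegral_image_simplexMap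
    (by rw [hdet]; exact inv_ne_zero (Finset.prod_ne_zero_iff.2 fun j _ => (hu0 j).ne'))
    (measurableSet_corner m), hdet, ← expect_bary 0, ← setIntegral_corner_eq]
  simp_rw [hsum]
  rfl

/-- Write `|t| = t + 2 max (-t) 0` with `t = ∑ u_j x_j - 1`: the linear part needs only first
moments, the rest is the cut-off tip at `p 0`. -/
theorem iota_one_simplex {m : ℕ} {p : Fin (m + 1) → EuclideanSpace ℝ (Fin m)}
    (hp : (linComb (edge p)).normDet ≠ 0) {η : EuclideanSpace ℝ (Fin m)} {s : ℝ} {u : Fin m → ℝ}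
    (hv : ⟪η, p 0⟫ = 1 - s) (hw : ∀ j, ⟪η, edge p j⟫ = s * u j) (hu : ∀ j, 1 < u j) :
    iota 1 (convexHull ℝ (Set.range p)) η
      = (linComb (edge p)).normDet * (|s| * ((m.factorial : ℝ)⁻¹ *
        ((∑ j, u j) / ((m : ℝ) + 1) - 1 + 2 / ((m : ℝ) + 1) * (∏ j, u j)⁻¹))) := by
  have habs (x : EuclideanSpace ℝ (Fin m)) : |⟪η, simplexMap p x⟫ - 1| ^ 1
      = |s| * ((∑ j, u j * x j) - 1 + 2 * max (1 - ∑ j, u j * x j) 0) := by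
    have h1 : ⟪η, simplexMap p x⟫ - 1 = s * ((∑ j, u j * x j) - 1) := by
      simp only [simplexMap, linComb_apply, inner_add_right, inner_sum, inner_smul_right, hv, hw]
      rw [mul_sub, Finset.mul_sum, Finset.sum_congr rfl fun j _ =>
        show x j * (s * u j) = s * (u j * x j) by ring]
      ring
    rw [pow_one, h1, abs_mul]
    congr 1
    rcases le_total (∑ j, u j * x j) 1 with h | h
    · rw [abs_of_nonpos (by linarith), max_eq_left (by linarith)]
      ring
    · rw [abs_of_nonneg (by linarith), max_eq_right (by linarith)]
      ring
  have hcl : Continuous fun x : EuclideanSpace ℝ (Fin m) => ∑ j, u j * x j :=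
    continuous_finsetSum _ fun j _ => continuous_const.mul (continuous_coord j)
  have hlin : ∫ x in corner m, ∑ j, u j * x j
      = (∑ j, u j) * ((m.factorial : ℝ)⁻¹ * (1 / ((m : ℝ) + 1))) := by
    have hint (j : Fin m) : IntegrableOn
        (fun x : EuclideanSpace ℝ (Fin m) => u j * x j) (corner m) :=
      integrableOn_corner (continuous_const.mul (continuous_coord j))
    rw [integral_finsetSum _ fun j _ => hint j, Finset.sum_mul]
    exact Finset.sum_congr rfl fun j _ => by rw [integral_const_mul, setIntegral_corner_coord]
  rw [iota, convexHull_range_eq_image, setIntegral_image_simplexMap hp (measurableSet_corner m)]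
  simp_rw [habs]
  rw [integral_const_mul, integral_add, integral_sub, hlin, integral_const_mul,
    setIntegral_corner_posPart hu, setIntegral_const, volume_real_corner, smul_eq_mul]
  · congr 2
    ring
  · exact integrableOn_corner hcl
  · exact integrableOn_corner continuous_const
  · exact integrableOn_corner (hcl.sub continuous_const)
  · exact integrableOn_corner
      (continuous_const.mul ((continuous_const.sub hcl).max continuous_const))

theorem normDet_edge_cutPoint {m : ℕ} {p : Fin (m + 2) → EuclideanSpace ℝ (Fin (m + 1))}
    {η : EuclideanSpace ℝ (Fin (m + 1))} {s : ℝ} {u : Fin (m + 1) → ℝ} (hs : s ≠ 0)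
    (hw : ∀ j, ⟪η, edge p j⟫ = s * u j) (hu : ∀ j, 1 < u j) :
    (linComb (edge (cutPoint p u))).normDet
      = (linComb (edge p)).normDet * ‖η‖ / (|s| * ∏ j, u j) := by
  have hu0 (j : Fin (m + 1)) : 0 < u j := one_pos.trans (hu j)
  have hη : η ≠ 0 := by
    rintro rfl
    have := hw 0
    rw [inner_zero_left] at this
    exact mul_ne_zero hs (hu0 0).ne' this.symm
  have hsub : (fun j => cutPoint p u j - p 0) = fun j => (u j)⁻¹ • edge p j := by
    funext j
    simp [cutPoint]
  have h := normDet_mul_of_inner_eq (q := cutPoint p u) (v := p 0) (s := s) hη fun j => by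
    rw [show cutPoint p u j - p 0 = (u j)⁻¹ • edge p j from congrFun hsub j, inner_smul_right, hw,
      mul_comm s, inv_mul_cancel_left₀ (hu0 j).ne']
  rw [hsub, normDet_linComb_smul] at h
  have hprod : ∏ j, |(u j)⁻¹| = (∏ j, u j)⁻¹ := by
    rw [← Finset.prod_inv_distrib]
    exact Finset.prod_congr rfl fun j _ => abs_of_pos (inv_pos.2 (hu0 j))
  have hP : ∏ j, u j ≠ 0 := Finset.prod_ne_zero_iff.2 fun j _ => (hu0 j).ne'
  rw [hprod] at h
  have hs' : |s| ≠ 0 := abs_ne_zero.2 hs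
  field_simp at h ⊢
  linarith

theorem volume_real_convexHull {m d : ℕ} (p : Fin (m + 1) → EuclideanSpace ℝ (Fin d)) :
    μHE[m].real (convexHull ℝ (Set.range p)) = (linComb (edge p)).normDet / m.factorial := by
  rw [convexHull_range_eq_image, Measure.real, euclideanHausdorffMeasure_image_simplexMap,
    ENNReal.toReal_mul, ENNReal.toReal_ofReal (LinearMap.normDet_nonneg _), ← Measure.real,
    volume_real_corner]
  ring

theorem zeta_simplex {m : ℕ} {p : Fin (m + 2) → EuclideanSpace ℝ (Fin (m + 1))}
    (hp : (linComb (edge p)).normDet ≠ 0)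
    {η : EuclideanSpace ℝ (Fin (m + 1))} {s : ℝ} {u : Fin (m + 1) → ℝ} (hs : s ≠ 0)
    (hv : ⟪η, p 0⟫ = 1 - s) (hw : ∀ j, ⟪η, edge p j⟫ = s * u j) (hu : ∀ j, 1 < u j) :
    zeta (convexHull ℝ (Set.range p)) η = ((m : ℝ) + 1) / (|s| * ∏ j, u j) := by
  have hη : ‖η‖ ≠ 0 := by
    intro h0
    have := hw 0
    rw [norm_eq_zero.1 h0, inner_zero_left] at this
    exact mul_ne_zero hs (one_pos.trans (hu 0)).ne' this.symm
  have hvol := volume_real_convexHull p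
  rw [EuclideanSpace.euclideanHausdorffMeasure_eq_volume] at hvol
  rw [zeta, Nat.add_sub_cancel, hyperplane_inter_convexHull hs hv hw hu, volume_real_convexHull,
    hvol, normDet_edge_cutPoint hs hw hu, Nat.factorial_succ]
  have hs' : |s| ≠ 0 := abs_ne_zero.2 hs
  have hP : ∏ j, u j ≠ 0 := Finset.prod_ne_zero_iff.2 fun j _ => (one_pos.trans (hu j)).ne'
  push_cast
  field_simp

theorem metricMoment_section {m : ℕ} {p : Fin (m + 2) → EuclideanSpace ℝ (Fin (m + 1))}
    (hp : (linComb (edge p)).normDet ≠ 0)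
    {η : EuclideanSpace ℝ (Fin (m + 1))} {s : ℝ} {u : Fin (m + 1) → ℝ} (hs : s ≠ 0)
    (hv : ⟪η, p 0⟫ = 1 - s) (hw : ∀ j, ⟪η, edge p j⟫ = s * u j) (hu : ∀ j, 1 < u j) :
    metricMoment m m 2 (hyperplane η ∩ convexHull ℝ (Set.range p))
      = m.factorial / (((m : ℝ) + 1) ^ m * ((m : ℝ) + 2) ^ m) := by
  rw [hyperplane_inter_convexHull hs hv hw hu, metricMoment_simplex]
  rw [normDet_edge_cutPoint hs hw hu]
  have hη : ‖η‖ ≠ 0 := by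
    intro h0
    have := hw 0
    rw [norm_eq_zero.1 h0, inner_zero_left] at this
    exact mul_ne_zero hs (one_pos.trans (hu 0)).ne' this.symm
  have hP : ∏ j, u j ≠ 0 := Finset.prod_ne_zero_iff.2 fun j _ => (one_pos.trans (hu j)).ne'
  exact div_ne_zero (mul_ne_zero hp hη) (mul_ne_zero (abs_ne_zero.2 hs) hP)

/-! ### Projective change of variables on the space of hyperplanes -/

/-- The projective map that translates the hyperplane `{x | ⟪η, x⟫ = 1}` by `v`. -/
noncomputable def dualTranslate {d : ℕ} (v η : EuclideanSpace ℝ (Fin d)) :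
    EuclideanSpace ℝ (Fin d) := (1 + ⟪v, η⟫)⁻¹ • η

/-- The functionals that exceed `1` on all vectors `w j`. -/
def dualOrthant {m d : ℕ} (w : Fin m → EuclideanSpace ℝ (Fin d)) : Set (EuclideanSpace ℝ (Fin d)) :=
  {η | ∀ j, 1 < ⟪w j, η⟫}

/-- The sign of `1 + ⟪p 0, ξ⟫` decides which of the two alternatives of the separation occurs; the
inverse map is `η ↦ (1 - ⟪η, p 0⟫)⁻¹ • η`. -/
theorem dualTranslate_image {m d : ℕ} {p : Fin (m + 1) → EuclideanSpace ℝ (Fin d)}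
    (hp : ∀ j : Fin m, p j.succ ≠ p 0) :
    dualTranslate (p 0) '' (dualOrthant (edge p) ∩ {η | 1 + ⟪p 0, η⟫ ≠ 0})
      = separatingSet (Set.range p) {p 0} := by
  have hV (P : EuclideanSpace ℝ (Fin d) → Prop) :
      (∀ x ∈ Set.range p \ {p 0}, P x) ↔ ∀ j : Fin m, P (p j.succ) := by
    constructor
    · exact fun h j => h _ ⟨⟨_, rfl⟩, hp j⟩
    · rintro h x ⟨⟨i, rfl⟩, hi⟩
      obtain rfl | ⟨j, rfl⟩ := Fin.eq_zero_or_eq_succ i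
      · exact absurd rfl hi
      · exact h j
  ext η
  simp only [separatingSet, Set.mem_union, Set.mem_ofPred_eq, hV, Set.mem_singleton_iff,
    forall_eq]
  constructor
  · rintro ⟨ξ, ⟨hξ, hr⟩, rfl⟩
    have hr : 1 + ⟪p 0, ξ⟫ ≠ 0 := hr
    have h0 : ⟪dualTranslate (p 0) ξ, p 0⟫ = 1 - (1 + ⟪p 0, ξ⟫)⁻¹ := by
      rw [dualTranslate, real_inner_smul_left, real_inner_comm (p 0) ξ]
      field_simp
      ring
    have h1 (j : Fin m) : ⟪dualTranslate (p 0) ξ, p j.succ⟫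
        = 1 + (1 + ⟪p 0, ξ⟫)⁻¹ * (⟪edge p j, ξ⟫ - 1) := by
      rw [dualTranslate, real_inner_smul_left, edge, inner_sub_left,
        real_inner_comm (p j.succ) ξ]
      field_simp
      ring
    simp only [h0, h1]
    rcases lt_or_gt_of_ne hr with h | h
    · right
      have := inv_lt_zero.2 h
      exact ⟨by linarith, fun j => by nlinarith [hξ j]⟩
    · left
      have := inv_pos.2 h
      exact ⟨by linarith, fun j => by nlinarith [hξ j]⟩
  · intro h
    have hs : 1 - ⟪η, p 0⟫ ≠ 0 := by
      rcases h with ⟨h, -⟩ | ⟨h, -⟩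
      · exact (sub_pos.2 h).ne'
      · exact (sub_neg.2 h).ne
    have hr : 1 + ⟪p 0, (1 - ⟪η, p 0⟫)⁻¹ • η⟫ = (1 - ⟪η, p 0⟫)⁻¹ := by
      rw [inner_smul_right, real_inner_comm η (p 0)]
      field_simp
      ring
    refine ⟨(1 - ⟪η, p 0⟫)⁻¹ • η, ⟨fun j => ?_, ?_⟩, ?_⟩
    · rw [edge, inner_smul_right, inner_sub_left, real_inner_comm η (p 0),
        real_inner_comm η (p j.succ)]
      rcases h with ⟨h, h'⟩ | ⟨h, h'⟩
      · rw [← div_eq_inv_mul, lt_div_iff₀ (sub_pos.2 h)]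
        linarith [h' j]
      · rw [← div_eq_inv_mul, lt_div_iff_of_neg (sub_neg.2 h)]
        linarith [h' j]
    · change 1 + ⟪p 0, (1 - ⟪η, p 0⟫)⁻¹ • η⟫ ≠ 0
      rw [hr]
      exact inv_ne_zero hs
    · rw [dualTranslate, hr, inv_inv, smul_smul, mul_inv_cancel₀ hs, one_smul]

/-- The derivative of `dualTranslate v`. -/
noncomputable def dualTranslateDeriv {d : ℕ} (v η : EuclideanSpace ℝ (Fin d)) :
    EuclideanSpace ℝ (Fin d) →L[ℝ] EuclideanSpace ℝ (Fin d) :=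
  (1 + ⟪v, η⟫)⁻¹ • ContinuousLinearMap.id ℝ _
    + (-((1 + ⟪v, η⟫) ^ 2)⁻¹ • innerSL ℝ v).smulRight η

theorem hasFDerivAt_dualTranslate {d : ℕ} {v η : EuclideanSpace ℝ (Fin d)}
    (h : 1 + ⟪v, η⟫ ≠ 0) : HasFDerivAt (dualTranslate v) (dualTranslateDeriv v η) η := by
  have h1 : HasFDerivAt (fun x => 1 + ⟪v, x⟫) (innerSL ℝ v) η :=
    ((innerSL ℝ v).hasFDerivAt).const_add 1
  have h2 := (hasDerivAt_inv h).comp_hasFDerivAt η h1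
  exact h2.smul (hasFDerivAt_id η)

/-- With `r = 1 + ⟪v, η⟫`, the derivative is `r⁻¹` times a transvection of determinant `1 - ⟪v, η⟫ /
r = r⁻¹`. -/
theorem det_dualTranslateDeriv {d : ℕ} {v η : EuclideanSpace ℝ (Fin d)}
    (h : 1 + ⟪v, η⟫ ≠ 0) :
    (dualTranslateDeriv v η).det = ((1 + ⟪v, η⟫) ^ (d + 1))⁻¹ := by
  have h1 : (dualTranslateDeriv v η : EuclideanSpace ℝ (Fin d) →ₗ[ℝ] EuclideanSpace ℝ (Fin d))
      = (1 + ⟪v, η⟫)⁻¹ • LinearMap.transvection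
        (-(1 + ⟪v, η⟫)⁻¹ • (innerSL ℝ v : EuclideanSpace ℝ (Fin d) →ₗ[ℝ] ℝ)) η := by
    ext x : 1
    simp [dualTranslateDeriv, LinearMap.transvection.apply, smul_smul]
    congr 1
    rw [sq, mul_inv]
    ring
  rw [ContinuousLinearMap.det, h1, LinearMap.det_smul, LinearMap.transvection.det,
    finrank_euclideanSpace_fin]
  simp only [LinearMap.smul_apply, ContinuousLinearMap.coe_coe, innerSL_apply_apply, smul_eq_mul]
  rw [pow_succ, inv_pow, mul_inv]
  congr 1
  field_simp
  ring

theorem injOn_dualTranslate {d : ℕ} (v : EuclideanSpace ℝ (Fin d)) :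
    Set.InjOn (dualTranslate v) {η | 1 + ⟪v, η⟫ ≠ 0} := by
  have key {ξ : EuclideanSpace ℝ (Fin d)} (h : 1 + ⟪v, ξ⟫ ≠ 0) :
      (1 - ⟪v, dualTranslate v ξ⟫)⁻¹ • dualTranslate v ξ = ξ := by
    have : 1 - ⟪v, dualTranslate v ξ⟫ = (1 + ⟪v, ξ⟫)⁻¹ := by
      rw [dualTranslate, inner_smul_right]
      field_simp
      ring
    rw [this, inv_inv, dualTranslate, smul_smul, mul_inv_cancel₀ h, one_smul]
  intro x hx y hy hxy
  rw [← key hx, ← key hy, hxy]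

theorem isOpen_dualOrthant {m d : ℕ} (w : Fin m → EuclideanSpace ℝ (Fin d)) :
    IsOpen (dualOrthant w) := by
  have : dualOrthant w = ⋂ j, {η | 1 < ⟪w j, η⟫} := by ext; simp [dualOrthant]
  rw [this]
  exact isOpen_iInter_of_finite fun j => isOpen_lt continuous_const (by fun_prop)

theorem ae_one_add_inner_ne_zero {d : ℕ} (v : EuclideanSpace ℝ (Fin d)) :
    ∀ᵐ η : EuclideanSpace ℝ (Fin d), 1 + ⟪v, η⟫ ≠ 0 := by
  let A : AffineSubspace ℝ (EuclideanSpace ℝ (Fin d)) :=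
    { carrier := {η | 1 + ⟪v, η⟫ = 0}
      smul_vsub_vadd_mem' := by
        intro c x y z hx hy hz
        simp only [Set.mem_ofPred_eq, vsub_eq_sub, vadd_eq_add, inner_add_right, inner_smul_right,
          inner_sub_right] at *
        linear_combination c * hx - c * hy + hz }
  -- The origin is never in `A`; this also covers `v = 0`, where `A` is empty.
  have hA : A ≠ ⊤ := by
    intro h
    have : (0 : EuclideanSpace ℝ (Fin d)) ∈ A := h ▸ AffineSubspace.mem_top ℝ _ _
    change 1 + ⟪v, 0⟫ = 0 at this
    simp at this
  have h0 := Measure.addHaar_affineSubspace volume A hA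
  rw [ae_iff]
  simpa using (show volume {η : EuclideanSpace ℝ (Fin d) | 1 + ⟪v, η⟫ = 0} = 0 from h0)

theorem setIntegral_separatingSet {m d : ℕ} {p : Fin (m + 1) → EuclideanSpace ℝ (Fin d)}
    (hp : ∀ j : Fin m, p j.succ ≠ p 0) (F : EuclideanSpace ℝ (Fin d) → ℝ) :
    ∫ η in separatingSet (Set.range p) {p 0}, F η
      = ∫ η in dualOrthant (edge p) ∩ {η | 1 + ⟪p 0, η⟫ ≠ 0},
        |1 + ⟪p 0, η⟫|⁻¹ ^ (d + 1) * F (dualTranslate (p 0) η) := by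
  have hm : MeasurableSet (dualOrthant (edge p) ∩ {η | 1 + ⟪p 0, η⟫ ≠ 0}) :=
    ((isOpen_dualOrthant _).inter
      (isOpen_ne_fun (continuous_const.add (by fun_prop)) continuous_const)).measurableSet
  rw [← dualTranslate_image hp, integral_image_eq_integral_abs_det_fderiv_smul volume hm
    (fun x hx => (hasFDerivAt_dualTranslate hx.2).hasFDerivWithinAt)
    ((injOn_dualTranslate _).mono Set.inter_subset_right)]
  refine setIntegral_congr_fun hm fun x hx => ?_
  rw [det_dualTranslateDeriv hx.2, smul_eq_mul, abs_inv, abs_pow, inv_pow]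

theorem setIntegral_inter_inner_ne {d : ℕ} (v : EuclideanSpace ℝ (Fin d))
    (S : Set (EuclideanSpace ℝ (Fin d))) (F : EuclideanSpace ℝ (Fin d) → ℝ) :
    ∫ η in S ∩ {η | 1 + ⟪v, η⟫ ≠ 0}, F η = ∫ η in S, F η := by
  refine setIntegral_congr_set ?_
  filter_upwards [ae_one_add_inner_ne_zero v] with η hη
  exact propext ⟨fun h => h.1, fun h => ⟨h, hη⟩⟩

/-- The adjoint of `linComb w` sends `η` to the vector of values `⟪w j, η⟫`, and its determinant has
absolute value `normDet`. -/
theorem setIntegral_dualOrthant {m : ℕ} {w : Fin m → EuclideanSpace ℝ (Fin m)}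
    (hw : (linComb w).normDet ≠ 0) (H : (Fin m → ℝ) → ℝ) :
    ∫ η in dualOrthant w, H (fun j => ⟪w j, η⟫)
      = (linComb w).normDet⁻¹ * ∫ u in Set.univ.pi fun _ => Set.Ioi 1, H u := by
  let A := LinearMap.adjoint (linComb w)
  have hA (η : EuclideanSpace ℝ (Fin m)) (j : Fin m) : A η j = ⟪w j, η⟫ := by
    have h := LinearMap.adjoint_inner_right (linComb w) (EuclideanSpace.single j 1) η
    rw [EuclideanSpace.inner_single_left] at h
    simpa [linComb_apply, Pi.single_apply, A] using h
  have hdet : |LinearMap.det A| = (linComb w).normDet := by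
    have h := LinearMap.normDet_sq (linComb w)
    rw [LinearMap.det_comp] at h
    have h2 : (linComb w).normDet ^ 2 = LinearMap.det A * LinearMap.det (linComb w) := h
    refine mul_right_cancel₀ hw ?_
    rw [← sq, ← abs_of_nonneg (sq_nonneg (linComb w).normDet), h2, abs_mul,
      ← LinearMap.normDet_eq_abs_det (linComb w)]
  have hdet0 : LinearMap.det A ≠ 0 := by
    rw [← abs_ne_zero, hdet]
    exact hw
  have hemb : MeasurableEmbedding A := by
    have hinj : Function.Injective A := by
      rw [← LinearMap.ker_eq_bot]
      by_contra h
      exact hdet0 (LinearMap.det_eq_zero_iff_ker_ne_bot.2 h)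
    exact A.continuous_of_finiteDimensional.measurableEmbedding hinj
  have hmap := Measure.map_linearMap_addHaar_eq_smul_addHaar
    (volume : Measure (EuclideanSpace ℝ (Fin m))) hdet0
  let e := (MeasurableEquiv.toLp 2 (Fin m → ℝ)).symm
  have he : MeasurePreserving e volume volume :=
    EuclideanSpace.volume_preserving_symm_measurableEquiv_toLp (Fin m)
  have hset : dualOrthant w = A ⁻¹' (e ⁻¹' (Set.univ.pi fun _ => Set.Ioi 1)) := by
    ext η
    simp only [dualOrthant, Set.mem_preimage, Set.mem_univ_pi, Set.mem_Ioi, Set.mem_ofPred_eq, ← hA]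
    rfl
  have hfun : ∀ η, H (fun j => ⟪w j, η⟫) = H (e (A η)) := fun η => by
    congr 1
    funext j
    exact (hA η j).symm
  simp_rw [hfun]
  rw [hset, ← he.setIntegral_preimage_emb e.measurableEmbedding,
    ← hemb.setIntegral_map (fun x => H (e x)), hmap, Measure.restrict_smul, integral_smul_measure,
    abs_inv, hdet, ENNReal.toReal_ofReal (inv_nonneg.2 (LinearMap.normDet_nonneg _)), smul_eq_mul]

/-! ### Power integrals over the orthant -/

theorem integrableOn_Ioi_inv_pow {k : ℕ} (hk : 2 ≤ k) :
    IntegrableOn (fun t : ℝ => (t ^ k)⁻¹) (Set.Ioi 1) := by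
  have h := integrableOn_Ioi_rpow_of_lt (a := -(k : ℝ)) (c := 1)
    (by have : (2 : ℝ) ≤ k := by exact_mod_cast hk
        linarith) one_pos
  refine h.congr_fun (fun t ht => ?_) measurableSet_Ioi
  have ht0 : (0 : ℝ) ≤ t := (one_pos.trans (show (1 : ℝ) < t from ht)).le
  change t ^ (-(k : ℝ)) = (t ^ k)⁻¹
  rw [Real.rpow_neg ht0, Real.rpow_natCast]

theorem integral_Ioi_inv_pow (k : ℕ) :
    ∫ t in Set.Ioi (1 : ℝ), (t ^ (k + 2))⁻¹ = 1 / ((k : ℝ) + 1) := by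
  have h := integral_Ioi_rpow_of_lt (a := -((k + 2 : ℕ) : ℝ)) (c := 1)
    (by push_cast
        have : (0 : ℝ) ≤ k := k.cast_nonneg
        linarith) one_pos
  rw [← setIntegral_congr_fun measurableSet_Ioi (f := fun t : ℝ => t ^ (-((k + 2 : ℕ) : ℝ))), h]
  · rw [Real.one_rpow]
    push_cast
    have h1 : -((k : ℝ) + 2) + 1 = -(k + 1) := by ring
    rw [h1, neg_div_neg_eq]
  · intro t ht
    have ht0 : (0 : ℝ) ≤ t := (one_pos.trans (show (1 : ℝ) < t from ht)).le
    change t ^ (-((k + 2 : ℕ) : ℝ)) = (t ^ (k + 2))⁻¹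
    rw [Real.rpow_neg ht0, Real.rpow_natCast]

theorem integrableOn_orthant_prod {m : ℕ} {k : Fin m → ℕ} (hk : ∀ i, 2 ≤ k i) :
    IntegrableOn (fun u : Fin m → ℝ => ∏ i, (u i ^ k i)⁻¹)
      (Set.univ.pi fun _ => Set.Ioi 1) := by
  rw [IntegrableOn, volume_pi, Measure.restrict_pi_pi]
  exact Integrable.fintype_prod (f := fun i t => (t ^ k i)⁻¹)
    fun i => integrableOn_Ioi_inv_pow (hk i)

theorem setIntegral_orthant_prod {m : ℕ} (k : Fin m → ℕ) :
    ∫ u in Set.univ.pi fun _ : Fin m => Set.Ioi (1 : ℝ), ∏ i, (u i ^ (k i + 2))⁻¹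
      = ∏ i, 1 / ((k i : ℝ) + 1) := by
  rw [volume_pi, Measure.restrict_pi_pi,
    integral_fintype_prod_eq_prod (f := fun i t => (t ^ (k i + 2))⁻¹)]
  exact Finset.prod_congr rfl fun i _ => integral_Ioi_inv_pow (k i)

/-- The sum term and the `-1` term both integrate to `(m + 2)⁻¹ ^ (m + 1)` in absolute value and
cancel, so only the last term survives. -/
theorem setIntegral_orthant (m : ℕ) :
    ∫ u in Set.univ.pi fun _ : Fin (m + 1) => Set.Ioi (1 : ℝ),
        ((∏ j, u j)⁻¹) ^ (m + 3) * ((∑ j, u j) / ((m : ℝ) + 2) - 1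
          + 2 / ((m : ℝ) + 2) * (∏ j, u j)⁻¹)
      = 2 / (((m : ℝ) + 2) * ((m : ℝ) + 3) ^ (m + 1)) := by
  have hm : MeasurableSet (Set.univ.pi fun _ : Fin (m + 1) => Set.Ioi (1 : ℝ)) :=
    MeasurableSet.univ_pi fun _ => measurableSet_Ioi
  -- Multiplication by `u j` lowers only the `j`-th exponent, from `m + 3` to `m + 2`.
  let κ (j i : Fin (m + 1)) : ℕ := if i = j then m else m + 1
  have hexp : ∀ u ∈ Set.univ.pi fun _ : Fin (m + 1) => Set.Ioi (1 : ℝ),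
      ((∏ j, u j)⁻¹) ^ (m + 3) * ((∑ j, u j) / ((m : ℝ) + 2) - 1
          + 2 / ((m : ℝ) + 2) * (∏ j, u j)⁻¹)
        = (1 / ((m : ℝ) + 2)) * (∑ j, ∏ i, (u i ^ (κ j i + 2))⁻¹)
          - ∏ i, (u i ^ (m + 1 + 2))⁻¹
          + 2 / ((m : ℝ) + 2) * ∏ i, (u i ^ (m + 2 + 2))⁻¹ := by
    intro u hu
    have hu0 (j : Fin (m + 1)) : u j ≠ 0 := (one_pos.trans (hu j (Set.mem_univ j))).ne'
    have h1 (j : Fin (m + 1)) : ∏ i, (u i ^ (κ j i + 2))⁻¹ = ((∏ j, u j)⁻¹) ^ (m + 3) * u j := by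
      have h2 (i : Fin (m + 1)) : (u i ^ (κ j i + 2))⁻¹
          = (u i ^ (m + 3))⁻¹ * (if i = j then u i else 1) := by
        simp only [κ]
        split_ifs
        · rw [pow_succ (u i) (m + 2), mul_inv, inv_mul_cancel_right₀ (hu0 i)]
        · rw [mul_one]
      simp_rw [h2]
      rw [Finset.prod_mul_distrib, Finset.prod_inv_distrib, Finset.prod_pow, inv_pow,
        Finset.prod_ite_eq' Finset.univ j u, if_pos (Finset.mem_univ j)]
    simp_rw [h1]
    rw [← Finset.mul_sum, Finset.prod_inv_distrib, Finset.prod_pow, Finset.prod_inv_distrib,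
      Finset.prod_pow, ← inv_pow, ← inv_pow]
    ring
  have hκ (j i : Fin (m + 1)) : 2 ≤ κ j i + 2 := Nat.le_add_left _ _
  have hsum : ∫ u in Set.univ.pi fun _ : Fin (m + 1) => Set.Ioi (1 : ℝ),
      ∑ j, ∏ i, (u i ^ (κ j i + 2))⁻¹ = (1 / ((m : ℝ) + 2)) ^ m := by
    rw [integral_finsetSum _ fun j _ => integrableOn_orthant_prod (hκ j)]
    have (j : Fin (m + 1)) : ∫ u in Set.univ.pi fun _ : Fin (m + 1) => Set.Ioi (1 : ℝ),
        ∏ i, (u i ^ (κ j i + 2))⁻¹ = 1 / ((m : ℝ) + 1) * (1 / ((m : ℝ) + 2)) ^ m := by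
      rw [setIntegral_orthant_prod, ← Finset.mul_prod_erase _ _ (Finset.mem_univ j)]
      rw [Finset.prod_congr rfl (g := fun _ => 1 / ((m : ℝ) + 2)) fun i hi => by
        simp only [κ, if_neg (Finset.ne_of_mem_erase hi)]
        push_cast
        ring]
      simp [κ]
    simp_rw [this]
    rw [Finset.sum_const, Finset.card_univ, Fintype.card_fin, nsmul_eq_mul]
    push_cast
    field_simp
  rw [setIntegral_congr_fun hm hexp, integral_add, integral_sub, integral_const_mul,
    integral_const_mul, hsum, setIntegral_orthant_prod fun _ => m + 1,
    setIntegral_orthant_prod fun _ => m + 2]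
  · simp only [Finset.prod_const, Finset.card_univ, Fintype.card_fin]
    push_cast
    rw [pow_succ' _ m, pow_succ' _ m, show (m : ℝ) + 1 + 1 = m + 2 by ring,
      show (m : ℝ) + 2 + 1 = m + 3 by ring, sub_self, zero_add, one_div_pow, pow_succ]
    field_simp
  · exact (integrable_finsetSum _ fun j _ => integrableOn_orthant_prod (hκ j)).const_mul _
  · exact integrableOn_orthant_prod fun _ => Nat.le_add_left _ _
  · exact ((integrable_finsetSum _ fun j _ => integrableOn_orthant_prod (hκ j)).const_mul _).sub
      (integrableOn_orthant_prod fun _ => Nat.le_add_left _ _)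
  · exact (integrableOn_orthant_prod fun _ => Nat.le_add_left _ _).const_mul _

/-! ### Assembly of the section integral -/

theorem normDet_linComb_ne_zero {m d : ℕ} {u : Fin m → EuclideanSpace ℝ (Fin d)}
    (hu : LinearIndependent ℝ u) : (linComb u).normDet ≠ 0 := by
  refine ((linComb u).normDet_ne_zero_tfae.out 0 4).2 ?_
  exact hu.fintypeLinearCombination_injective.comp (WithLp.linearEquiv 2 ℝ (Fin m → ℝ)).injective

theorem normDet_edge_ne_zero {m d : ℕ} {p : Fin (m + 1) → EuclideanSpace ℝ (Fin d)}
    (hp : AffineIndependent ℝ p) : (linComb (edge p)).normDet ≠ 0 := by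
  refine normDet_linComb_ne_zero ?_
  have h := (affineIndependent_iff_linearIndependent_vsub ℝ p 0).1 hp
  exact h.comp (fun j : Fin m => (⟨j.succ, Fin.succ_ne_zero j⟩ : {x : Fin (m + 1) // x ≠ 0}))
    fun i j hij => Fin.succ_injective _ (congrArg Subtype.val hij)

/-- With `s = (1 + ⟪p 0, ξ⟫)⁻¹`, the Jacobian gives `|s| ^ (m + 2)`, `zeta` gives `|s| ^ (-(m + 3))`
and `iota` gives `|s|`: the product depends on `ξ` only through the inner products with the edges.
-/
theorem section_integrand {m : ℕ} {p : Fin (m + 2) → EuclideanSpace ℝ (Fin (m + 1))}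
    (hp : (linComb (edge p)).normDet ≠ 0) {ξ : EuclideanSpace ℝ (Fin (m + 1))}
    (hξ : ξ ∈ dualOrthant (edge p)) (hr : 1 + ⟪p 0, ξ⟫ ≠ 0) :
    |1 + ⟪p 0, ξ⟫|⁻¹ ^ (m + 1 + 1) *
      (metricMoment (m + 1 - 1) (m + 1 - 1) (1 + 1)
          (hyperplane (dualTranslate (p 0) ξ) ∩ convexHull ℝ (Set.range p))
        * zeta (convexHull ℝ (Set.range p)) (dualTranslate (p 0) ξ) ^ (m + 1 + 1 + 1)
        * iota 1 (convexHull ℝ (Set.range p)) (dualTranslate (p 0) ξ))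
      = (m.factorial / (((m : ℝ) + 1) ^ m * ((m : ℝ) + 2) ^ m) * ((m : ℝ) + 1) ^ (m + 3)
          * (linComb (edge p)).normDet * ((m + 1).factorial : ℝ)⁻¹) *
        (((∏ j, ⟪edge p j, ξ⟫)⁻¹) ^ (m + 3) * ((∑ j, ⟪edge p j, ξ⟫) / ((m : ℝ) + 2) - 1
          + 2 / ((m : ℝ) + 2) * (∏ j, ⟪edge p j, ξ⟫)⁻¹)) := by
  have hs : (1 + ⟪p 0, ξ⟫)⁻¹ ≠ 0 := inv_ne_zero hr
  have hv : ⟪dualTranslate (p 0) ξ, p 0⟫ = 1 - (1 + ⟪p 0, ξ⟫)⁻¹ := by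
    rw [dualTranslate, real_inner_smul_left, real_inner_comm (p 0) ξ]
    field_simp
    ring
  have hw (j : Fin (m + 1)) : ⟪dualTranslate (p 0) ξ, edge p j⟫
      = (1 + ⟪p 0, ξ⟫)⁻¹ * ⟪edge p j, ξ⟫ := by
    rw [dualTranslate, real_inner_smul_left, real_inner_comm (edge p j) ξ]
  rw [Nat.add_sub_cancel, show 1 + 1 = 2 from rfl,
    metricMoment_section hp hs hv hw hξ, zeta_simplex hp hs hv hw hξ,
    iota_one_simplex hp hv hw hξ, abs_inv]
  have ha : |1 + ⟪p 0, ξ⟫| ≠ 0 := abs_ne_zero.2 hr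
  have hP : ∏ j, ⟪edge p j, ξ⟫ ≠ 0 :=
    Finset.prod_ne_zero_iff.2 fun j _ => (one_pos.trans (hξ j)).ne'
  rw [div_pow, mul_pow, inv_pow, inv_pow, inv_pow, show m + 3 = m + 1 + 1 + 1 from rfl,
    pow_succ |1 + ⟪p 0, ξ⟫| (m + 1 + 1)]
  push_cast
  rw [show (m : ℝ) + 1 + 1 = m + 2 by ring]
  -- This factor is common to both sides and is kept opaque for `field_simp`.
  generalize (∑ j, ⟪edge p j, ξ⟫) / ((m : ℝ) + 2) - 1
    + 2 / ((m : ℝ) + 2) * (∏ j, ⟪edge p j, ξ⟫)⁻¹ = G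
  field_simp

/-- The `normDet` contributed by `iota` cancels the inverse one from the passage to `u`, so the
value is independent of the simplex. -/
theorem sectionIntegral_simplex {m : ℕ} {p : Fin (m + 2) → EuclideanSpace ℝ (Fin (m + 1))}
    (hp : AffineIndependent ℝ p) :
    sectionIntegral 1 (Set.range p) {p 0}
      = 2 * ((m + 1).factorial : ℝ) / (((m : ℝ) + 2) ^ (m + 1) * ((m : ℝ) + 3) ^ (m + 1)) := by
  have hdet := normDet_edge_ne_zero hp
  have hmeas : MeasurableSet (dualOrthant (edge p) ∩ {η | 1 + ⟪p 0, η⟫ ≠ 0}) :=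
    ((isOpen_dualOrthant _).inter
      (isOpen_ne_fun (continuous_const.add (by fun_prop)) continuous_const)).measurableSet
  rw [sectionIntegral, setIntegral_separatingSet fun j => hp.injective.ne (Fin.succ_ne_zero j),
    setIntegral_congr_fun hmeas fun ξ hξ => section_integrand hdet hξ.1 hξ.2,
    setIntegral_inter_inner_ne, integral_const_mul,
    setIntegral_dualOrthant hdet (fun u => ((∏ j, u j)⁻¹) ^ (m + 3) *
      ((∑ j, u j) / ((m : ℝ) + 2) - 1 + 2 / ((m : ℝ) + 2) * (∏ j, u j)⁻¹)),
    setIntegral_orthant, Nat.add_sub_cancel, Nat.factorial_succ]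
  push_cast
  have := Nat.factorial_ne_zero m
  rw [pow_succ ((m : ℝ) + 2), pow_succ ((m : ℝ) + 1) (m + 2), pow_succ ((m : ℝ) + 1) (m + 1),
    pow_succ ((m : ℝ) + 1) m]
  field_simp

end SimplexSection

theorem mainTheorem10 (d : ℕ) (hd : 1 ≤ d)
    (T : Affine.Simplex ℝ (EuclideanSpace ℝ (Fin d)) d) (i : Fin (d + 1)) :
    SimplexSection.sectionIntegral 1 (Set.range T.points) {T.points i}
        = 2 * SimplexSection.metricMoment d d 2 (convexHull ℝ (Set.range T.points)) ∧
      2 * SimplexSection.metricMoment d d 2 (convexHull ℝ (Set.range T.points))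
        = 2 * (d.factorial : ℝ) / (((d : ℝ) + 1) ^ d * ((d : ℝ) + 2) ^ d) := by
  have hmoment := SimplexSection.metricMoment_simplex T.points
    (SimplexSection.normDet_edge_ne_zero T.independent)
  obtain ⟨m, rfl⟩ := Nat.exists_eq_add_of_le' hd
  -- Swapping indices makes the chosen vertex the zeroth one without changing the vertex set.
  have h := SimplexSection.sectionIntegral_simplex
    (T.independent.comp_embedding (Equiv.swap 0 i).toEmbedding)
  have hrange : Set.range (T.points ∘ Equiv.swap 0 i) = Set.range T.points :=
    (Equiv.swap 0 i).surjective.range_comp _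
  simp only [Equiv.coe_toEmbedding, hrange, Function.comp_apply, Equiv.swap_apply_left] at h
  rw [h, hmoment]
  push_cast
  constructor <;> ring
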